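/- For integers $a,b,c\geq 1$ let $\Delta(a,b,c)=\langle x,y : x^{a}=y^{b}=(yx)^{c}=1\rangle$ be the triangle group of type $(a,b,c)$. For a connected, locally connected, locally compact Hausdorff space $Z$, a nested sequence in $Z$ is a decreasing sequence $U_1\supset U_2\supset\cdots$ of non-empty connected open subsets of $Z$ with compact boundaries such that $\bigcap_n \overline{U_n}=\emptyset$ and every compact subset of $Z$ is disjoint from some $U_m$. Two nested sequences $(U_n)$ and $(U'_n)$ are equivalent if for every $n$ there are $j,k$ with $U_n\supset U'_j$ and $U'_n\supset U_k$. An end of $Z$ is an equivalence class of nested sequences. The ends of a finitely generated group $G$ are the ends of the geometric realization of its Cayley graph $\mathrm{Cay}(G,\mathcal C)$, where $\mathcal C$ is a finite generating set of $G$ closed under inversion, the vertices are the elements of $G$, and two distinct vertices $g_1,g_2$ are joined by an edge if and only if $g_1h=g_2$ for some $h\in\mathcal C$. Then, for every choice of the finite generating set $\mathcal C$ of $\Delta(a,b,c)$ closed under inversion: 1. If $\frac1a+\frac1b+\frac1c\leq 1$, then $\Delta(a,b,c)$ has exactly one end. 2. If $\Delta(a,b,c)$ is finite, then it has no ends. 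-/

import Mathlib

/-- The triangle group `Δ(a,b,c) = ⟨x, y : x ^ a = y ^ b = (y x) ^ c = 1⟩`, where `x` and `y` are
the generators with index `0` and `1`. -/
abbrev TriangleGroup (a b c : ℕ) : Type :=
  PresentedGroup ({FreeGroup.of 0 ^ a, FreeGroup.of 1 ^ b,
    (FreeGroup.of 1 * FreeGroup.of 0) ^ c} : Set (FreeGroup (Fin 2)))

/-- A nested sequence in a topological space `Z`: a decreasing sequence of non-empty connected open
sets with compact boundary, whose closures have empty intersection, and which eventually leaves
every compact set. -/
structure NestedSequence (Z : Type*) [TopologicalSpace Z] where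
  U : ℕ → Set Z
  isOpen : ∀ n, IsOpen (U n)
  /-- `IsConnected` includes non-emptiness. -/
  isConnected : ∀ n, IsConnected (U n)
  antitone : Antitone U
  isCompact_frontier : ∀ n, IsCompact (frontier (U n))
  iInter_closure : ⋂ n, closure (U n) = ∅
  eventually_disjoint : ∀ K : Set Z, IsCompact K → ∃ m, K ∩ U m = ∅

/-- Two nested sequences are equivalent if every member of either one contains a member of the
other one. -/
instance NestedSequence.instSetoid (Z : Type*) [TopologicalSpace Z] :
    Setoid (NestedSequence Z) where
  r S T := ∀ n, ∃ j k, T.U j ⊆ S.U n ∧ S.U k ⊆ T.U n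
  iseqv :=
    { refl := fun _ n => ⟨n, n, subset_rfl, subset_rfl⟩
      symm := fun h n => by
        obtain ⟨j, k, h1, h2⟩ := h n
        exact ⟨k, j, h2, h1⟩
      trans := fun h h' n => by
        obtain ⟨j, _, h1, _⟩ := h n
        obtain ⟨p, _, h3, _⟩ := h' j
        obtain ⟨_, k, _, h2⟩ := h' n
        obtain ⟨_, q, _, h4⟩ := h k
        exact ⟨p, q, h3.trans h1, h4.trans h2⟩ }

/-- The ends of a topological space: the equivalence classes of nested sequences. -/
def TopEnds (Z : Type*) [TopologicalSpace Z] : Type _ :=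
  Quotient (NestedSequence.instSetoid Z)

open Classical in
/-- The geometric realization of a graph, in barycentric coordinates: the union in `V → ℝ` of the
unit coordinate vectors (the vertices) and of the segments that join the coordinate vectors of
adjacent vertices (the edges). It carries the subspace topology of the product topology; for
locally finite graphs, such as Cayley graphs of finite generating sets, this is the usual topology
(that of a one-dimensional cell complex). -/
def SimpleGraph.realization {V : Type*} (G : SimpleGraph V) : Set (V → ℝ) :=
  {w | ∃ u v : V, (u = v ∨ G.Adj u v) ∧ w ∈ segment ℝ (Pi.single u (1 : ℝ)) (Pi.single v (1 : ℝ))}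

/-- The ends of a group `G` computed with the generating set `C`: the ends of the geometric
realization of the Cayley graph of `G` with respect to `C`. -/
def GroupEnds {G : Type*} [Group G] (C : Set G) : Type _ :=
  TopEnds (SimpleGraph.mulCayley C).realization

/-! Write `G` for the group and `z = yx`. Infinitude and one-endedness both rest on exactness of the
Fox complex over `ℚ[G]` (`exists_invariant_decomposition`): finitely supported `p`, `q` whose
increments along `z` and `y` cancel have the form `p = r + s`, `q = t - s`, with `r`, `s`, `t` right
invariant under `z`, `x`, `y`.

One end: if `f` on `G` has finite coboundary, then along each of `x`, `y`, `z`, of finite order, it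
has the increments of a finitely supported function `u`, `v`, `w`. The pair `(w - u, u - v)`
satisfies the cycle condition, and the resulting `s` makes `f - (u + s)` invariant under both
generators, hence constant. So `f` is almost constant (`exists_finite_ne`). For `f` labelling the
components left by a finite vertex set, this gives a cofinite component, hence an end when `G` is
infinite. For `f` the indicator of the vertices in a member of a nested sequence, it shows that the
member has relatively compact complement (`exists_isCompact_compl_subset`), so the end is unique.

Infinitude: for finite `G`, exactness and a dimension count bound `|G| + 1` by the sum of the
indices of `⟨x⟩`, `⟨y⟩`, `⟨z⟩` (`card_add_one_le`). These generators have orders exactly `a`, `b`,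
`c`, as seen in `PGL₂(ℂ)`, so the bound contradicts `1/a + 1/b + 1/c ≤ 1`.

A finite Cayley graph has compact realization, which admits no nested sequence. -/

section Affine

/-! ### Affine permutations of a module -/

variable {R N : Type*} [Ring R] [AddCommGroup N] [Module R N]

/-- The affine permutation `n ↦ u • n + d` of a module. -/
def affinePerm (u : Rˣ) (d : N) : Equiv.Perm N where
  toFun n := u • n + d
  invFun n := u⁻¹ • (n - d)
  left_inv n := by simp
  right_inv n := by simp

lemma affinePerm_apply (u : Rˣ) (d n : N) : affinePerm u d n = u • n + d := rfl

lemma affinePerm_one_zero : affinePerm (1 : Rˣ) (0 : N) = 1 := by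
  ext n; simp [affinePerm_apply]

lemma affinePerm_mul (u v : Rˣ) (d e : N) :
    affinePerm u d * affinePerm v e = affinePerm (u * v) (u • e + d) := by
  ext n; simp [affinePerm_apply, mul_smul, add_assoc]

lemma affinePerm_inv (u : Rˣ) (d : N) :
    (affinePerm u d)⁻¹ = affinePerm u⁻¹ (-(u⁻¹ • d)) := by
  rw [inv_eq_iff_mul_eq_one, affinePerm_mul]
  simp [affinePerm_one_zero]

lemma affinePerm_pow (u : Rˣ) (d : N) (k : ℕ) :
    affinePerm u d ^ k = affinePerm (u ^ k) ((∑ i ∈ Finset.range k, (u : R) ^ i) • d) := by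
  induction k with
  | zero => simp [affinePerm_one_zero]
  | succ k ih =>
    rw [pow_succ, ih, affinePerm_mul, Finset.sum_range_succ, add_smul, pow_succ, add_comm]
    simp [Units.smul_def]

end Affine

/-! ### Generators, universal property and derivations -/

namespace TriangleGroup

variable (a b c : ℕ)

/-- The generator `x` of the triangle group. -/
def X : TriangleGroup a b c := PresentedGroup.of 0

/-- The generator `y` of the triangle group. -/
def Y : TriangleGroup a b c := PresentedGroup.of 1

lemma X_pow : X a b c ^ a = 1 := by
  have := PresentedGroup.one_of_mem (rels := ({FreeGroup.of 0 ^ a, FreeGroup.of 1 ^ b,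
    (FreeGroup.of 1 * FreeGroup.of 0) ^ c} : Set (FreeGroup (Fin 2)))) (x := FreeGroup.of 0 ^ a)
    (by simp)
  rwa [map_pow] at this

lemma Y_pow : Y a b c ^ b = 1 := by
  have := PresentedGroup.one_of_mem (rels := ({FreeGroup.of 0 ^ a, FreeGroup.of 1 ^ b,
    (FreeGroup.of 1 * FreeGroup.of 0) ^ c} : Set (FreeGroup (Fin 2)))) (x := FreeGroup.of 1 ^ b)
    (by simp)
  rwa [map_pow] at this

lemma YX_pow : (Y a b c * X a b c) ^ c = 1 := by
  have := PresentedGroup.one_of_mem (rels := ({FreeGroup.of 0 ^ a, FreeGroup.of 1 ^ b,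
    (FreeGroup.of 1 * FreeGroup.of 0) ^ c} : Set (FreeGroup (Fin 2))))
    (x := (FreeGroup.of 1 * FreeGroup.of 0) ^ c) (by simp)
  rwa [map_pow, map_mul] at this

variable {a b c}

lemma eq_top_of_mem {H : Subgroup (TriangleGroup a b c)} (hx : X a b c ∈ H) (hy : Y a b c ∈ H)
    (g : TriangleGroup a b c) : g ∈ H := by
  apply PresentedGroup.generated_by
  intro j
  fin_cases j
  exacts [hx, hy]

lemma exists_lift {H : Type*} [Group H] (x y : H) (hx : x ^ a = 1) (hy : y ^ b = 1)
    (hyx : (y * x) ^ c = 1) :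
    ∃ φ : TriangleGroup a b c →* H, φ (X a b c) = x ∧ φ (Y a b c) = y := by
  refine ⟨PresentedGroup.toGroup (f := ![x, y]) ?_, ?_, ?_⟩
  · rintro r (rfl | rfl | rfl) <;> simp [hx, hy, hyx]
  · simp [X]
  · simp [Y]

/-- A derivation is the translation part of a homomorphism to affine permutations with linear part
`τ`, so the universal property leaves only the relators to check; a power relator contributes a
geometric sum. -/
lemma exists_derivation {R N : Type*} [Ring R] [AddCommGroup N] [Module R N]
    (τ : TriangleGroup a b c →* Rˣ) (dx dy : N)
    (hx : (∑ i ∈ Finset.range a, (τ (X a b c) : R) ^ i) • dx = 0)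
    (hy : (∑ i ∈ Finset.range b, (τ (Y a b c) : R) ^ i) • dy = 0)
    (hz : (∑ i ∈ Finset.range c, (τ (Y a b c * X a b c) : R) ^ i) •
      (τ (Y a b c) • dx + dy) = 0) :
    ∃ D : TriangleGroup a b c → N, D (X a b c) = dx ∧ D (Y a b c) = dy ∧
      ∀ g h, D (g * h) = τ g • D h + D g := by
  obtain ⟨φ, hφx, hφy⟩ := exists_lift (a := a) (b := b) (c := c)
    (affinePerm (τ (X a b c)) dx) (affinePerm (τ (Y a b c)) dy)
    (by rw [affinePerm_pow, hx, ← map_pow, X_pow, map_one, affinePerm_one_zero])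
    (by rw [affinePerm_pow, hy, ← map_pow, Y_pow, map_one, affinePerm_one_zero])
    (by rw [affinePerm_mul, affinePerm_pow, ← map_mul, hz, ← map_pow, YX_pow, map_one,
      affinePerm_one_zero])
  have key : ∀ g, ∃ d, φ g = affinePerm (τ g) d := by
    let H : Subgroup (TriangleGroup a b c) :=
      { carrier := {g | ∃ d, φ g = affinePerm (τ g) d}
        one_mem' := ⟨0, by rw [map_one, map_one, affinePerm_one_zero]⟩
        mul_mem' := by
          rintro g h ⟨d, hd⟩ ⟨e, he⟩
          exact ⟨_, by rw [map_mul, hd, he, affinePerm_mul, ← map_mul]⟩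
        inv_mem' := by
          rintro g ⟨d, hd⟩
          exact ⟨_, by rw [map_inv, hd, affinePerm_inv, ← map_inv]⟩ }
    exact eq_top_of_mem (H := H) ⟨_, hφx⟩ ⟨_, hφy⟩
  have key' : ∀ g n, φ g n = τ g • n + φ g 0 := by
    intro g n
    obtain ⟨d, hd⟩ := key g
    simp [hd, affinePerm_apply]
  refine ⟨fun g => φ g 0, ?_, ?_, ?_⟩
  · simp [hφx, affinePerm_apply]
  · simp [hφy, affinePerm_apply]
  · intro g h
    simp only [map_mul, Equiv.Perm.mul_apply]
    exact key' g _

end TriangleGroup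

/-! ### Norm elements and linearized derivations in the group algebra -/

section GroupAlgebra

open MonoidAlgebra

variable {G : Type*} [Group G]

/-- The norm element `1 + g + ⋯ + g ^ (k - 1)` of the rational group algebra. -/
noncomputable def normElt (g : G) (k : ℕ) : MonoidAlgebra ℚ G :=
  ∑ i ∈ Finset.range k, of ℚ G g ^ i

lemma normElt_mul_of {g : G} {k : ℕ} (h : g ^ k = 1) :
    normElt g k * of ℚ G g = normElt g k := by
  have := geom_sum_mul (of ℚ G g) k
  rw [← map_pow, h, map_one, sub_self, mul_sub, mul_one, sub_eq_zero] at this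
  exact this

lemma mul_normElt_mul_of_inv {g : G} {k : ℕ} (h : g ^ k = 1) (m : MonoidAlgebra ℚ G) :
    m * normElt g k * of ℚ G g⁻¹ = m * normElt g k := by
  conv_lhs => rw [← normElt_mul_of h]
  rw [mul_assoc, mul_assoc, ← map_mul, mul_inv_cancel, map_one, mul_one]

lemma coeff_mul_of_inv (m : MonoidAlgebra ℚ G) (g h : G) :
    (m * of ℚ G h⁻¹).coeff g = m.coeff (g * h) := by
  simp [of_apply]

/-- A derivation into a module over the group algebra, extended linearly, is evaluated at a
multiple of `g - 1` through its value at `g`. -/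
lemma linearCombination_mul_sub_one {N : Type*} [AddCommGroup N] [Module (MonoidAlgebra ℚ G) N]
    [Module ℚ N] [IsScalarTower ℚ (MonoidAlgebra ℚ G) N] (D : G → N)
    (hD : ∀ g h, D (g * h) = of ℚ G g • D h + D g) (p : MonoidAlgebra ℚ G) (h : G) :
    Finsupp.linearCombination ℚ D (p * (of ℚ G h - 1)).coeff = p • D h := by
  induction p using induction_linear with
  | zero => simp
  | add p q hp hq => rw [add_mul, coeff_add, map_add, hp, hq, add_smul]
  | single g r =>
    have : single g r = r • of ℚ G g := by simp
    rw [mul_sub, mul_one, coeff_sub, map_sub, this, smul_mul_assoc, ← map_mul, coeff_smul,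
      coeff_smul, map_smul, map_smul, ← smul_sub, smul_assoc]
    simp [hD]

end GroupAlgebra

/-! ### Exactness of the Fox complex -/

namespace TriangleGroup

open MonoidAlgebra

variable {a b c : ℕ}

/-- Modulo the Fox derivatives of the relators, a universal derivation takes the basis values at
`(yx)⁻¹` and `y⁻¹`; its linear extension turns the hypothesis into the vanishing of the class of
`(p, q)`. -/
lemma exists_eq_of_mul_sub_one_add_mul_sub_one_eq_zero
    (p q : MonoidAlgebra ℚ (TriangleGroup a b c))
    (h : p * (of ℚ _ (Y a b c * X a b c)⁻¹ - 1) + q * (of ℚ _ (Y a b c)⁻¹ - 1) = 0) :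
    ∃ r s t : MonoidAlgebra ℚ (TriangleGroup a b c),
      p = r * normElt (Y a b c * X a b c) c + s * normElt (X a b c) a ∧
      q = t * normElt (Y a b c) b - s * normElt (X a b c) a := by
  let A := MonoidAlgebra ℚ (TriangleGroup a b c)
  have hx := X_pow a b c
  have hy := Y_pow a b c
  have hyx := YX_pow a b c
  set x := X a b c
  set y := Y a b c
  let R : Submodule A (A × A) :=
    Submodule.span A {(normElt (y * x) c, 0), (0, normElt y b), (normElt x a, -normElt x a)}
  let ι : A × A →ₗ[A] (A × A) ⧸ R := R.mkQ
  have hι : ∀ v ∈ R, ι v = 0 := fun v hv => (Submodule.Quotient.mk_eq_zero R).2 hv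
  let τ : TriangleGroup a b c →* Aˣ := (of ℚ (TriangleGroup a b c)).toHomUnits
  have hτ : ∀ g, (τ g : A) = of ℚ _ g := fun g => rfl
  have h1 : (of ℚ _ y • (-of ℚ _ x, 1) + (0, -of ℚ _ y) : A × A) = (-of ℚ _ (y * x), 0) := by
    rw [Prod.smul_mk]
    simp only [smul_eq_mul, Prod.mk_add_mk, map_mul, mul_one, mul_neg, add_zero, add_neg_cancel]
  -- These values are forced by `D (y * x)⁻¹ = ι (1, 0)` and `D y⁻¹ = ι (0, 1)`.
  obtain ⟨D, hDx, hDy, hD⟩ := exists_derivation τ (ι (-of ℚ _ x, 1)) (ι (0, -of ℚ _ y))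
    (by
      rw [hτ, ← map_smul]
      apply hι
      have : ((∑ i ∈ Finset.range a, of ℚ _ x ^ i) • (-of ℚ _ x, 1) : A × A)
          = -(normElt x a, -normElt x a) := by
        change (normElt x a * -of ℚ _ x, normElt x a * 1) = _
        rw [mul_neg, normElt_mul_of hx]
        simp
      rw [this]
      exact R.neg_mem (Submodule.subset_span (by simp)))
    (by
      rw [hτ, ← map_smul]
      apply hι
      have : ((∑ i ∈ Finset.range b, of ℚ _ y ^ i) • (0, -of ℚ _ y) : A × A)
          = -(0, normElt y b) := by
        change (normElt y b * 0, normElt y b * -of ℚ _ y) = _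
        rw [mul_neg, normElt_mul_of hy]
        simp
      rw [this]
      exact R.neg_mem (Submodule.subset_span (by simp)))
    (by
      rw [Units.smul_def, hτ, hτ, ← map_smul, ← map_add, ← map_smul]
      apply hι
      have : ((∑ i ∈ Finset.range c, of ℚ _ (y * x) ^ i) • (-of ℚ _ (y * x), 0) : A × A)
          = -(normElt (y * x) c, 0) := by
        change (normElt (y * x) c * -of ℚ _ (y * x), normElt (y * x) c * 0) = _
        rw [mul_neg, normElt_mul_of hyx]
        simp
      rw [h1, this]
      exact R.neg_mem (Submodule.subset_span (by simp)))
  have hD1 : D 1 = 0 := by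
    have := hD 1 1
    simpa using this
  have hDinv : ∀ g, D g⁻¹ = -(of ℚ _ g⁻¹ • D g) := by
    intro g
    have := hD g⁻¹ g
    rw [inv_mul_cancel, hD1, Units.smul_def, hτ] at this
    exact (neg_eq_of_add_eq_zero_right this.symm).symm
  have hcancel : ∀ g : TriangleGroup a b c, of ℚ _ g⁻¹ * of ℚ _ g = 1 := by
    intro g; rw [← map_mul, inv_mul_cancel, map_one]
  have hDy' : D y⁻¹ = ι (0, 1) := by
    rw [hDinv, hDy, ← map_smul, ← map_neg, Prod.smul_mk, smul_zero, smul_eq_mul, mul_neg, hcancel]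
    simp
  have hDz' : D (y * x)⁻¹ = ι (1, 0) := by
    have : D (y * x) = ι (-of ℚ _ (y * x), 0) := by
      rw [hD, hDx, hDy, Units.smul_def, hτ, ← map_smul, ← map_add, h1]
    rw [hDinv, this, ← map_smul, ← map_neg, Prod.smul_mk, smul_zero, smul_eq_mul, mul_neg, hcancel]
    simp
  have h0 := congrArg (fun m : A => Finsupp.linearCombination ℚ D m.coeff) h
  simp only [coeff_add, map_add] at h0
  rw [linearCombination_mul_sub_one D hD, linearCombination_mul_sub_one D hD, hDy', hDz',
    ← map_smul, ← map_smul, ← map_add] at h0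
  have hmem : (p, q) ∈ R := by
    rw [← Submodule.Quotient.mk_eq_zero R]
    have : (p, q) = p • ((1, 0) : A × A) + q • ((0, 1) : A × A) := by simp
    rw [this]
    exact h0
  obtain ⟨r, t, s, hrst⟩ := Submodule.mem_span_triple.1 hmem
  rw [Prod.ext_iff] at hrst
  refine ⟨r, s, t, ?_, ?_⟩
  · simpa using hrst.1.symm
  · have h2 : q = t * normElt y b + s * -normElt x a := by simpa using hrst.2.symm
    rw [h2, sub_eq_add_neg]
    exact congrArg _ (mul_neg _ _)

end TriangleGroup

/-! ### Almost invariant functions -/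

section

open MonoidAlgebra

/-- A function that is almost invariant under right multiplication by an element of finite order
has the same increments as a finitely supported function. -/
lemma exists_monoidAlgebra_sub_eq {G : Type*} [Group G] (f : G → ℚ) {x : G} {a : ℕ} (ha : 0 < a)
    (hx : x ^ a = 1) (hf : {g | f (g * x) ≠ f g}.Finite) :
    ∃ u : MonoidAlgebra ℚ G, ∀ g, u.coeff (g * x) - u.coeff g = f (g * x) - f g := by
  classical
  have hfin : (Subgroup.zpowers x : Set G).Finite := by
    have : IsOfFinOrder x := isOfFinOrder_iff_pow_eq_one.2 ⟨a, ha, hx⟩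
    exact this.finite_zpowers
  -- `B` is the union of the cosets of `⟨x⟩` on which `f` is not constant; the function sought is
  -- `f` cut off outside `B`.
  let B : Set G := {g | ∃ h ∈ Subgroup.zpowers x, f (g * h * x) ≠ f (g * h)}
  have hB : B.Finite := by
    refine (Set.Finite.image2 (fun d h => d * h⁻¹) hf hfin).subset ?_
    rintro g ⟨h, hh, hg⟩
    exact ⟨g * h, hg, h, hh, by simp⟩
  have hBx : ∀ g, g * x ∈ B ↔ g ∈ B := by
    intro g
    constructor
    · rintro ⟨h, hh, hg⟩
      exact ⟨x * h, mul_mem (Subgroup.mem_zpowers x) hh, by simpa only [mul_assoc] using hg⟩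
    · rintro ⟨h, hh, hg⟩
      exact ⟨x⁻¹ * h, mul_mem (inv_mem (Subgroup.mem_zpowers x)) hh, by
        simpa only [mul_assoc, mul_inv_cancel_left] using hg⟩
  have hu : (Function.support fun g => if g ∈ B then f g else 0).Finite := by
    refine hB.subset fun g hg => ?_
    by_contra h
    simp [h] at hg
  refine ⟨ofCoeff (Finsupp.ofSupportFinite _ hu), fun g => ?_⟩
  simp only [Finsupp.ofSupportFinite_coe, hBx]
  split_ifs with h
  · rfl
  · by_contra hne
    exact h ⟨1, one_mem _, fun he => hne (by simp at he; simp [he])⟩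

end

namespace TriangleGroup

open MonoidAlgebra

variable {a b c : ℕ}

/-- Exactness of the Fox complex of the triangle group, in terms of coefficients. -/
lemma exists_invariant_decomposition (p q : MonoidAlgebra ℚ (TriangleGroup a b c))
    (h : ∀ g, p.coeff (g * (Y a b c * X a b c)) - p.coeff g +
      (q.coeff (g * Y a b c) - q.coeff g) = 0) :
    ∃ r s t : MonoidAlgebra ℚ (TriangleGroup a b c), p = r + s ∧ q = t - s ∧
      (∀ g, r.coeff (g * (Y a b c * X a b c)) = r.coeff g) ∧
      (∀ g, s.coeff (g * X a b c) = s.coeff g) ∧ ∀ g, t.coeff (g * Y a b c) = t.coeff g := by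
  obtain ⟨r, s, t, hp, hq⟩ := exists_eq_of_mul_sub_one_add_mul_sub_one_eq_zero p q (by
    ext g
    rw [mul_sub, mul_sub, mul_one, mul_one]
    simp only [coeff_add, coeff_sub, Finsupp.add_apply, Finsupp.sub_apply, coeff_mul_of_inv]
    simpa using h g)
  refine ⟨_, _, _, hp, hq, fun g => ?_, fun g => ?_, fun g => ?_⟩
  · rw [← coeff_mul_of_inv, mul_normElt_mul_of_inv (YX_pow a b c)]
  · rw [← coeff_mul_of_inv, mul_normElt_mul_of_inv (X_pow a b c)]
  · rw [← coeff_mul_of_inv, mul_normElt_mul_of_inv (Y_pow a b c)]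

/-- Almost invariant functions on a triangle group are almost constant. -/
theorem exists_finite_ne (ha : 0 < a) (hb : 0 < b) (hc : 0 < c) (f : TriangleGroup a b c → ℚ)
    (hX : {g | f (g * X a b c) ≠ f g}.Finite) (hY : {g | f (g * Y a b c) ≠ f g}.Finite) :
    ∃ k, {g | f g ≠ k}.Finite := by
  have hZ : {g | f (g * (Y a b c * X a b c)) ≠ f g}.Finite := by
    refine (hY.union (hX.preimage (mul_left_injective (Y a b c)).injOn)).subset fun g hg => ?_
    by_contra hcon
    simp only [Set.mem_union, Set.mem_preimage, Set.mem_ofPred_eq, not_or, not_not] at hcon hg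
    exact hg (by rw [← mul_assoc, hcon.2, hcon.1])
  obtain ⟨u, hu⟩ := exists_monoidAlgebra_sub_eq f ha (X_pow a b c) hX
  obtain ⟨v, hv⟩ := exists_monoidAlgebra_sub_eq f hb (Y_pow a b c) hY
  obtain ⟨w, hw⟩ := exists_monoidAlgebra_sub_eq f hc (YX_pow a b c) hZ
  -- The cycle condition: the increment of `f` along `yx` is that along `y` at `g` plus that along
  -- `x` at `g * y`.
  obtain ⟨r, s, t, hp, hq, -, hs, ht⟩ := exists_invariant_decomposition (w - u) (u - v) (by
    intro g
    have h1 := hu (g * Y a b c)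
    have h2 := hv g
    have h3 := hw g
    rw [← mul_assoc] at h3 ⊢
    simp only [coeff_sub, Finsupp.sub_apply]
    linarith)
  have hv' : v = u + s - t := by
    rw [sub_eq_iff_eq_add] at hq
    rw [hq]; abel
  -- Since `u + s = v + t`, this `F` is both `f - u - s`, invariant under `x`, and `f - v - t`,
  -- invariant under `y`.
  let F : TriangleGroup a b c → ℚ := fun g => f g - (u + s).coeff g
  have hFX : ∀ g, F (g * X a b c) = F g := by
    intro g
    have := hu g
    simp only [F, coeff_add, Finsupp.add_apply, hs]
    linarith
  have hFY : ∀ g, F (g * Y a b c) = F g := by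
    intro g
    have := hv g
    simp only [hv', coeff_sub, coeff_add, Finsupp.sub_apply, Finsupp.add_apply, ht] at this
    simp only [F, coeff_add, Finsupp.add_apply]
    linarith
  let H : Subgroup (TriangleGroup a b c) :=
    { carrier := {h | ∀ g, F (g * h) = F g}
      one_mem' := fun g => by rw [mul_one]
      mul_mem' := fun {h k} hh hk g => by rw [← mul_assoc, hk, hh]
      inv_mem' := fun {h} hh g => by rw [← hh (g * h⁻¹), inv_mul_cancel_right] }
  have hF : ∀ g, F g = F 1 := by
    intro g
    have : g ∈ H := eq_top_of_mem (H := H) hFX hFY g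
    simpa using this 1
  refine ⟨F 1, ((u + s).coeff.support.finite_toSet).subset fun g hg => ?_⟩
  by_contra h
  rw [Finset.mem_coe, Finsupp.notMem_support_iff] at h
  apply hg
  rw [← hF g]
  simp only [F, h, sub_zero]

end TriangleGroup

/-! ### Elements of prescribed order in `PGL₂(ℂ)` -/

section Matrices

open Matrix

/-- Cayley–Hamilton iterated; the factor `ξ - η` avoids division. A power of a non-scalar `M` with
`ξ ≠ η` is thus scalar exactly when `ξ ^ k = η ^ k`. -/
lemma smul_pow_eq_of_trace_eq (M : Matrix (Fin 2) (Fin 2) ℂ) {ξ η : ℂ} (hξ : ξ * η = 1)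
    (hdet : M.det = 1) (htr : M.trace = ξ + η) (k : ℕ) :
    (ξ - η) • M ^ k = (ξ ^ k - η ^ k) • M - (η * ξ ^ k - ξ * η ^ k) • 1 := by
  have hM : M * M = (ξ + η) • M - 1 := by
    rw [← htr]
    rw [det_fin_two] at hdet
    ext i j
    fin_cases i <;> fin_cases j <;>
      simp [Matrix.mul_apply, trace_fin_two] <;>
      first | ring1 | linear_combination hdet | linear_combination -hdet
  induction k with
  | zero => ext i j; simp; ring
  | succ k ih =>
    rw [pow_succ, ← smul_mul_assoc, ih, sub_mul, smul_mul_assoc, hM, smul_mul_assoc, one_mul]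
    ext i j
    simp only [Matrix.sub_apply, Matrix.smul_apply, smul_eq_mul]
    linear_combination (-(1 : Matrix (Fin 2) (Fin 2) ℂ) i j) * (η ^ k - ξ ^ k) * hξ

lemma apply_eq_of_mem_center {u : (Matrix (Fin 2) (Fin 2) ℂ)ˣ} (hu : u ∈ Subgroup.center _) :
    (u : Matrix (Fin 2) (Fin 2) ℂ) 0 1 = 0 ∧
      (u : Matrix (Fin 2) (Fin 2) ℂ) 0 0 = (u : Matrix (Fin 2) (Fin 2) ℂ) 1 1 := by
  rw [Subgroup.mem_center_iff] at hu
  let D : (Matrix (Fin 2) (Fin 2) ℂ)ˣ := Matrix.nonsingInvUnit !![1, 0; 0, -1] (by simp)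
  let T : (Matrix (Fin 2) (Fin 2) ℂ)ˣ := Matrix.nonsingInvUnit !![1, 1; 0, 1] (by simp)
  have hD : (D : Matrix (Fin 2) (Fin 2) ℂ) = !![1, 0; 0, -1] := rfl
  have hT : (T : Matrix (Fin 2) (Fin 2) ℂ) = !![1, 1; 0, 1] := rfl
  have h1 := hu D
  have h2 := hu T
  have h1' := congrArg (fun v : (Matrix (Fin 2) (Fin 2) ℂ)ˣ => (v : Matrix (Fin 2) (Fin 2) ℂ) 0 1) h1
  have h2' := congrArg (fun v : (Matrix (Fin 2) (Fin 2) ℂ)ˣ => (v : Matrix (Fin 2) (Fin 2) ℂ) 0 1) h2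
  simp [hD, hT, Matrix.mul_apply] at h1' h2'
  refine ⟨?_, ?_⟩
  · linear_combination h1' / 2
  · linear_combination -h2'

/-- The order in `PGL₂(ℂ)` of a matrix of determinant one, in terms of its eigenvalues. -/
lemma orderOf_mk_center {u : (Matrix (Fin 2) (Fin 2) ℂ)ˣ} {ξ η : ℂ} (hξ : ξ * η = 1) {a : ℕ}
    (ha : 2 ≤ a) (hprim : IsPrimitiveRoot (ξ ^ 2) a)
    (hdet : (u : Matrix (Fin 2) (Fin 2) ℂ).det = 1)
    (htr : (u : Matrix (Fin 2) (Fin 2) ℂ).trace = ξ + η)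
    (hu : (u : Matrix (Fin 2) (Fin 2) ℂ) 0 1 ≠ 0 ∨
      (u : Matrix (Fin 2) (Fin 2) ℂ) 0 0 ≠ (u : Matrix (Fin 2) (Fin 2) ℂ) 1 1) :
    orderOf (QuotientGroup.mk u : (Matrix (Fin 2) (Fin 2) ℂ)ˣ ⧸ Subgroup.center _) = a := by
  have hpow : ∀ k : ℕ, ξ ^ k = η ^ k ↔ a ∣ k := by
    intro k
    rw [← hprim.pow_eq_one_iff_dvd, ← pow_mul, mul_comm 2 k, pow_mul, sq]
    have hk : ξ ^ k * η ^ k = 1 := by rw [← mul_pow, hξ, one_pow]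
    constructor
    · intro h; rw [← hk, h]
    · intro h
      have h0 : ξ ^ k ≠ 0 := left_ne_zero_of_mul_eq_one hk
      exact mul_left_cancel₀ h0 (h.trans hk.symm)
  have hne : ξ - η ≠ 0 := by
    rw [sub_ne_zero]
    intro h
    have := (hpow 1).1 (by simpa using h)
    have := Nat.le_of_dvd one_pos this
    omega
  suffices h : ∀ k : ℕ, u ^ k ∈ Subgroup.center (Matrix (Fin 2) (Fin 2) ℂ)ˣ ↔ a ∣ k by
    apply Nat.dvd_right_iff_eq.1
    intro k
    rw [orderOf_dvd_iff_pow_eq_one, ← QuotientGroup.mk_pow, QuotientGroup.eq_one_iff, h]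
  intro k
  rw [← hpow]
  have key := smul_pow_eq_of_trace_eq _ hξ hdet htr k
  constructor
  · intro h
    obtain ⟨h1, h2⟩ := apply_eq_of_mem_center h
    rw [Units.val_pow_eq_pow_val] at h1 h2
    have e01 := congrFun (congrFun key 0) 1
    have e00 := congrFun (congrFun key 0) 0
    have e11 := congrFun (congrFun key 1) 1
    simp only [Matrix.sub_apply, Matrix.smul_apply, smul_eq_mul, h1, h2] at e01 e00 e11
    simp only [mul_zero, ne_eq, zero_ne_one, not_false_eq_true, one_apply_ne, sub_zero, one_apply_eq]
      at e01 e00 e11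
    rw [← sub_eq_zero]
    rcases hu with hu | hu
    · exact (mul_eq_zero.1 e01.symm).resolve_right hu
    · have : (ξ ^ k - η ^ k) * ((u : Matrix (Fin 2) (Fin 2) ℂ) 0 0 -
          (u : Matrix (Fin 2) (Fin 2) ℂ) 1 1) = 0 := by linear_combination e11 - e00
      exact (mul_eq_zero.1 this).resolve_right (sub_ne_zero.2 hu)
  · intro h
    rw [h, sub_self, zero_smul, zero_sub, ← neg_smul] at key
    have key' : (u : Matrix (Fin 2) (Fin 2) ℂ) ^ k =
        ((ξ - η)⁻¹ * -(η * η ^ k - ξ * η ^ k)) • 1 := by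
      rw [mul_smul, ← key, smul_smul, inv_mul_cancel₀ hne, one_smul]
    rw [Subgroup.mem_center_iff]
    intro g
    ext1
    rw [Units.val_mul, Units.val_mul, Units.val_pow_eq_pow_val, key']
    simp

/-- The square is prescribed because the order in `PGL₂(ℂ)` is that of the eigenvalue ratio `ξ / ξ⁻¹
= ξ ^ 2`. -/
lemma exists_sq_isPrimitiveRoot {a : ℕ} (ha : 2 ≤ a) :
    ∃ ξ : ℂ, ξ ≠ 0 ∧ ξ ≠ ξ⁻¹ ∧ IsPrimitiveRoot (ξ ^ 2) a := by
  have hprim := Complex.isPrimitiveRoot_exp a (by omega)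
  obtain ⟨ξ, hξ⟩ := IsAlgClosed.exists_pow_nat_eq (Complex.exp (2 * Real.pi * Complex.I / a))
    (n := 2) two_pos
  have h0 : ξ ≠ 0 := by
    rintro rfl
    exact Complex.exp_ne_zero _ (by rw [← hξ]; simp)
  rw [← hξ] at hprim
  refine ⟨ξ, h0, fun h => hprim.ne_one (by omega) ?_, hprim⟩
  rw [sq]
  nth_rewrite 2 [h]
  exact mul_inv_cancel₀ h0

/-- For `a, b, c ≥ 2` there are elements of `PGL₂(ℂ)` of orders `a` and `b` whose product has
order `c`. -/
lemma exists_orderOf_eq {a b c : ℕ} (ha : 2 ≤ a) (hb : 2 ≤ b) (hc : 2 ≤ c) :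
    ∃ x y : (Matrix (Fin 2) (Fin 2) ℂ)ˣ ⧸ Subgroup.center (Matrix (Fin 2) (Fin 2) ℂ)ˣ,
      orderOf x = a ∧ orderOf y = b ∧ orderOf (y * x) = c := by
  obtain ⟨ξ, hξ0, hξ, hξa⟩ := exists_sq_isPrimitiveRoot ha
  obtain ⟨η, hη0, hη, hηb⟩ := exists_sq_isPrimitiveRoot hb
  obtain ⟨θ, hθ0, hθ, hθc⟩ := exists_sq_isPrimitiveRoot hc
  -- Chosen so that the product of `B` and `A` below has trace `θ + θ⁻¹`.
  let t : ℂ := θ + θ⁻¹ - η * ξ - η⁻¹ * ξ⁻¹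
  let A : (Matrix (Fin 2) (Fin 2) ℂ)ˣ := Matrix.nonsingInvUnit !![ξ, 1; 0, ξ⁻¹] (by
    simp [det_fin_two, hξ0])
  let B : (Matrix (Fin 2) (Fin 2) ℂ)ˣ := Matrix.nonsingInvUnit !![η, 0; t, η⁻¹] (by
    simp [det_fin_two, hη0])
  have hA : (A : Matrix (Fin 2) (Fin 2) ℂ) = !![ξ, 1; 0, ξ⁻¹] := rfl
  have hB : (B : Matrix (Fin 2) (Fin 2) ℂ) = !![η, 0; t, η⁻¹] := rfl
  refine ⟨QuotientGroup.mk A, QuotientGroup.mk B, ?_, ?_, ?_⟩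
  · refine orderOf_mk_center (mul_inv_cancel₀ hξ0) ha hξa ?_ ?_ (Or.inl ?_)
    · simp [hA, det_fin_two, hξ0]
    · simp [hA, trace_fin_two]
    · simp [hA]
  · refine orderOf_mk_center (mul_inv_cancel₀ hη0) hb hηb ?_ ?_ (Or.inr ?_)
    · simp [hB, det_fin_two, hη0]
    · simp [hB, trace_fin_two]
    · simpa [hB] using hη
  · rw [← QuotientGroup.mk_mul]
    refine orderOf_mk_center (mul_inv_cancel₀ hθ0) hc hθc ?_ ?_ (Or.inl ?_)
    · simp [hA, hB, det_fin_two]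
      field_simp
      ring
    · simp [hA, hB, trace_fin_two, t]
    · simp [hA, hB, hη0]

end Matrices

/-! ### Exact orders of the generators, and infinitude -/

namespace TriangleGroup

variable {a b c : ℕ}

lemma orderOf_generators (ha : 2 ≤ a) (hb : 2 ≤ b) (hc : 2 ≤ c) :
    orderOf (X a b c) = a ∧ orderOf (Y a b c) = b ∧ orderOf (Y a b c * X a b c) = c := by
  obtain ⟨x, y, hx, hy, hyx⟩ := exists_orderOf_eq ha hb hc
  obtain ⟨φ, hφx, hφy⟩ := exists_lift (a := a) (b := b) (c := c) x y
    (orderOf_dvd_iff_pow_eq_one.1 hx.dvd) (orderOf_dvd_iff_pow_eq_one.1 hy.dvd)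
    (orderOf_dvd_iff_pow_eq_one.1 hyx.dvd)
  refine ⟨Nat.dvd_antisymm (orderOf_dvd_of_pow_eq_one (X_pow a b c)) ?_,
    Nat.dvd_antisymm (orderOf_dvd_of_pow_eq_one (Y_pow a b c)) ?_,
    Nat.dvd_antisymm (orderOf_dvd_of_pow_eq_one (YX_pow a b c)) ?_⟩
  · simpa only [hφx, hx] using orderOf_map_dvd φ (X a b c)
  · simpa only [hφy, hy] using orderOf_map_dvd φ (Y a b c)
  · simpa only [map_mul, hφx, hφy, hyx] using orderOf_map_dvd φ (Y a b c * X a b c)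

end TriangleGroup

namespace TriangleGroup

variable {a b c : ℕ}

lemma two_le_of_inv_add_inv_add_inv_le {a b c : ℕ} (ha : 0 < a) (hb : 0 < b) (hc : 0 < c)
    (h : (1 / a + 1 / b + 1 / c : ℚ) ≤ 1) : 2 ≤ a ∧ 2 ≤ b ∧ 2 ≤ c := by
  have ha' : (0 : ℚ) < 1 / a := by positivity
  have hb' : (0 : ℚ) < 1 / b := by positivity
  have hc' : (0 : ℚ) < 1 / c := by positivity
  refine ⟨?_, ?_, ?_⟩ <;> by_contra! hlt
  · obtain rfl : a = 1 := by omega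
    rw [Nat.cast_one, div_one] at h
    linarith
  · obtain rfl : b = 1 := by omega
    rw [Nat.cast_one, div_one] at h
    linarith
  · obtain rfl : c = 1 := by omega
    rw [Nat.cast_one, div_one] at h
    linarith

lemma card_quotient_zpowers {G : Type*} [Group G] [Finite G] (g : G) :
    (Nat.card (G ⧸ Subgroup.zpowers g) : ℚ) = Nat.card G * (1 / orderOf g) := by
  have h := Subgroup.card_eq_card_quotient_mul_card_subgroup (Subgroup.zpowers g)
  rw [Nat.card_zpowers] at h
  have h0 : (orderOf g : ℚ) ≠ 0 := by
    exact_mod_cast (orderOf_pos g).ne'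
  rw [h]
  push_cast
  field_simp

/-- Right invariance under `g` makes `r` a function on the cosets of `⟨g⟩`, so the choice of
representative is harmless. -/
lemma apply_out_mk {G : Type*} [Group G] {g : G} {r : G → ℚ} (hr : ∀ h, r (h * g) = r h) (h : G) :
    r (QuotientGroup.mk h : G ⧸ Subgroup.zpowers g).out = r h := by
  let H : Subgroup G :=
    { carrier := {k | ∀ h, r (h * k) = r h}
      one_mem' := fun h => by rw [mul_one]
      mul_mem' := fun {k l} hk hl h => by rw [← mul_assoc, hl, hk]
      inv_mem' := fun {k} hk h => by rw [← hk (h * k⁻¹), inv_mul_cancel_right] }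
  have hle : Subgroup.zpowers g ≤ H := by
    rw [Subgroup.zpowers_le]
    exact hr
  obtain ⟨k, hk⟩ := QuotientGroup.mk_out_eq_mul (Subgroup.zpowers g) h
  rw [hk]
  exact hle k.2 h

/-- The Euler characteristic bound for a finite triangle group, from exactness of its Fox complex. -/
lemma card_add_one_le [Finite (TriangleGroup a b c)] :
    Nat.card (TriangleGroup a b c) + 1 ≤
      Nat.card (TriangleGroup a b c ⧸ Subgroup.zpowers (Y a b c * X a b c)) +
      Nat.card (TriangleGroup a b c ⧸ Subgroup.zpowers (Y a b c)) +
      Nat.card (TriangleGroup a b c ⧸ Subgroup.zpowers (X a b c)) := by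
  classical
  have := Fintype.ofFinite (TriangleGroup a b c)
  have hfin : ∀ g : TriangleGroup a b c, Finite (TriangleGroup a b c ⧸ Subgroup.zpowers g) :=
    fun g => inferInstance
  set G := TriangleGroup a b c
  set x : G := X a b c
  set y : G := Y a b c
  have := Fintype.ofFinite (G ⧸ Subgroup.zpowers x)
  have := Fintype.ofFinite (G ⧸ Subgroup.zpowers y)
  have := Fintype.ofFinite (G ⧸ Subgroup.zpowers (y * x))
  let δ (g : G) : (G → ℚ) →ₗ[ℚ] (G → ℚ) := LinearMap.funLeft ℚ ℚ (· * g) - LinearMap.id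
  have hδ : ∀ g p h, δ g p h = p (h * g) - p h := fun g p h => rfl
  -- The range of `d` lies in the sum-zero functions, so with `n = |G|` its kernel has dimension at
  -- least `2n - (n - 1) = n + 1`. Exactness puts this kernel in the range of `ψ`, whose source has
  -- the sum of the indices as dimension.
  let d : (G → ℚ) × (G → ℚ) →ₗ[ℚ] (G → ℚ) := (δ (y * x)).coprod (δ y)
  let σ : (G → ℚ) →ₗ[ℚ] ℚ := ∑ g : G, LinearMap.proj g
  have hσ : ∀ p, σ p = ∑ g, p g := fun p => by simp [σ]
  have hσδ : ∀ g p, σ (δ g p) = 0 := by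
    intro g p
    simp only [hσ, hδ, Finset.sum_sub_distrib]
    rw [sub_eq_zero]
    exact Equiv.sum_comp (Equiv.mulRight g) p
  have hrange : LinearMap.range d ≤ LinearMap.ker σ := by
    rintro _ ⟨⟨p, q⟩, rfl⟩
    rw [LinearMap.mem_ker]
    simp [d, hσδ]
  have hσsurj : Function.Surjective σ := by
    intro q
    refine ⟨Pi.single 1 q, ?_⟩
    rw [hσ, Finset.sum_pi_single']
    simp
  have e1 := LinearMap.finrank_range_add_finrank_ker σ
  rw [LinearMap.range_eq_top.2 hσsurj, finrank_top, Module.finrank_self,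
    Module.finrank_fintype_fun_eq_card] at e1
  have e2 := LinearMap.finrank_range_add_finrank_ker d
  rw [Module.finrank_prod, Module.finrank_fintype_fun_eq_card] at e2
  have e3 := Submodule.finrank_mono hrange
  let π (g : G) : (G ⧸ Subgroup.zpowers g → ℚ) →ₗ[ℚ] (G → ℚ) :=
    LinearMap.funLeft ℚ ℚ QuotientGroup.mk
  let ψ : (G ⧸ Subgroup.zpowers (y * x) → ℚ) × (G ⧸ Subgroup.zpowers y → ℚ) ×
      (G ⧸ Subgroup.zpowers x → ℚ) →ₗ[ℚ] (G → ℚ) × (G → ℚ) :=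
    ((π (y * x)).coprod ((0 : _ →ₗ[ℚ] _).coprod (π x))).prod
      ((0 : _ →ₗ[ℚ] _).coprod ((π y).coprod (-π x)))
  have hker : LinearMap.ker d ≤ LinearMap.range ψ := by
    rintro ⟨p, q⟩ hpq
    obtain ⟨r, s, t, hp, hq, hr, hs, ht⟩ := exists_invariant_decomposition
      (MonoidAlgebra.ofCoeff (Finsupp.equivFunOnFinite.symm p))
      (MonoidAlgebra.ofCoeff (Finsupp.equivFunOnFinite.symm q)) (by
        intro g
        exact congrFun hpq g)
    refine ⟨(fun k => r.coeff k.out, fun k => t.coeff k.out, fun k => s.coeff k.out), ?_⟩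
    apply Prod.ext
    · funext g
      have := DFunLike.congr_fun (congrArg MonoidAlgebra.coeff hp) g
      simp only [MonoidAlgebra.coeff_add, Finsupp.add_apply] at this
      change r.coeff _ + (0 + s.coeff _) = p g
      rw [apply_out_mk hr, apply_out_mk hs, zero_add]
      exact this.symm
    · funext g
      have := DFunLike.congr_fun (congrArg MonoidAlgebra.coeff hq) g
      simp only [MonoidAlgebra.coeff_sub, Finsupp.sub_apply] at this
      change 0 + (t.coeff _ + -s.coeff _) = q g
      rw [apply_out_mk ht, apply_out_mk hs, zero_add, ← sub_eq_add_neg]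
      exact this.symm
  have e4 := (Submodule.finrank_mono hker).trans (LinearMap.finrank_range_le ψ)
  rw [Module.finrank_prod, Module.finrank_prod, Module.finrank_fintype_fun_eq_card,
    Module.finrank_fintype_fun_eq_card, Module.finrank_fintype_fun_eq_card] at e4
  simp only [← Nat.card_eq_fintype_card] at e1 e2 e4
  change Nat.card G + 1 ≤ Nat.card (G ⧸ Subgroup.zpowers (y * x)) +
    Nat.card (G ⧸ Subgroup.zpowers y) + Nat.card (G ⧸ Subgroup.zpowers x)
  omega

/-- Euclidean and hyperbolic triangle groups are infinite. -/
theorem infinite_of_inv_add_inv_add_inv_le (ha : 0 < a) (hb : 0 < b) (hc : 0 < c)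
    (h : (1 / a + 1 / b + 1 / c : ℚ) ≤ 1) : Infinite (TriangleGroup a b c) := by
  by_contra hfin
  rw [not_infinite_iff_finite] at hfin
  obtain ⟨ha2, hb2, hc2⟩ := two_le_of_inv_add_inv_add_inv_le ha hb hc h
  obtain ⟨hX, hY, hYX⟩ := orderOf_generators ha2 hb2 hc2
  have key : (Nat.card (TriangleGroup a b c) + 1 : ℚ) ≤
      Nat.card (TriangleGroup a b c ⧸ Subgroup.zpowers (Y a b c * X a b c)) +
      Nat.card (TriangleGroup a b c ⧸ Subgroup.zpowers (Y a b c)) +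
      Nat.card (TriangleGroup a b c ⧸ Subgroup.zpowers (X a b c)) := by
    exact_mod_cast card_add_one_le
  rw [card_quotient_zpowers, card_quotient_zpowers, card_quotient_zpowers, hX, hY, hYX] at key
  have hn : (0 : ℚ) ≤ Nat.card (TriangleGroup a b c) := by positivity
  have := mul_le_mul_of_nonneg_left h hn
  linarith

end TriangleGroup

/-! ### Ends of topological spaces -/

lemma IsPreconnected.inter_frontier_nonempty_of_isOpen {Z : Type*} [TopologicalSpace Z]
    {t U : Set Z} (ht : IsPreconnected t) (hU : IsOpen U) {p q : Z} (hp : p ∈ t) (hpU : p ∈ U)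
    (hq : q ∈ t) (hqU : q ∉ U) : (t ∩ frontier U).Nonempty := by
  by_contra hne
  have hfr : ∀ w ∈ t, w ∉ frontier U := fun w hw hwf => hne ⟨w, hw, hwf⟩
  have hcl : ∀ w ∈ t, w ∉ U → w ∉ closure U := fun w hw hwU hwc =>
    hfr w hw (by rw [hU.frontier_eq]; exact ⟨hwc, hwU⟩)
  obtain ⟨w, -, hwU, hwc⟩ := ht U (closure U)ᶜ hU isClosed_closure.isOpen_compl
    (fun w hw => by
      by_cases hwU : w ∈ U
      · exact Or.inl hwU
      · exact Or.inr (hcl w hw hwU))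
    ⟨p, hp, hpU⟩ ⟨q, hq, hcl q hq hqU⟩
  exact hwc (subset_closure hwU)

lemma NestedSequence.isEmpty_of_compactSpace (Z : Type*) [TopologicalSpace Z] [CompactSpace Z] :
    IsEmpty (NestedSequence Z) := by
  refine ⟨fun T => ?_⟩
  obtain ⟨m, hm⟩ := T.eventually_disjoint Set.univ isCompact_univ
  rw [Set.univ_inter] at hm
  exact (T.isConnected m).nonempty.ne_empty hm

/-- Every nested sequence leaves the compact set containing the complement of `S.U n`, hence
eventually enters `S.U n`; so all are equivalent, and `T` supplies existence. -/
lemma TopEnds.card_eq_one {Z : Type*} [TopologicalSpace Z] (T : NestedSequence Z)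
    (h : ∀ (S : NestedSequence Z) (n : ℕ), ∃ L, IsCompact L ∧ (S.U n)ᶜ ⊆ L) :
    ENat.card (TopEnds Z) = 1 := by
  have key : ∀ S S' : NestedSequence Z, ∀ n, ∃ j, S'.U j ⊆ S.U n := by
    intro S S' n
    obtain ⟨L, hL, hSL⟩ := h S n
    obtain ⟨j, hj⟩ := S'.eventually_disjoint L hL
    refine ⟨j, fun w hw => ?_⟩
    by_contra hwS
    exact (Set.eq_empty_iff_forall_notMem.1 hj) w ⟨hSL hwS, hw⟩
  rw [ENat.card_eq_one_iff_unique]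
  refine ⟨⟨⟨Quotient.mk _ T⟩, fun E => ?_⟩⟩
  induction E using Quotient.inductionOn with
  | h S =>
    refine Quotient.sound fun n => ?_
    obtain ⟨j, hj⟩ := key S T n
    obtain ⟨k, hk⟩ := key T S n
    exact ⟨j, k, hj, hk⟩

/-! ### Topology of the geometric realization -/

namespace SimpleGraph

variable {V : Type*} (Γ : SimpleGraph V)

namespace realization

open Classical in
/-- The segment in `V → ℝ` that joins two coordinate vectors. -/
def seg (u v : V) : Set (V → ℝ) := segment ℝ (Pi.single u (1 : ℝ)) (Pi.single v (1 : ℝ))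

lemma mem_seg_apply {u v : V} {w : V → ℝ} (hw : w ∈ seg u v) (x : V) :
    0 ≤ w x ∧ (w x ≠ 0 → x = u ∨ x = v) := by
  classical
  obtain ⟨s, t, hs, ht, -, rfl⟩ := hw
  simp only [Pi.add_apply, Pi.smul_apply, smul_eq_mul, Pi.single_apply]
  refine ⟨by split_ifs <;> simp [hs, ht, add_nonneg], ?_⟩
  contrapose!
  rintro ⟨h1, h2⟩
  simp [h1, h2]

lemma single_mem_seg_left [DecidableEq V] (u v : V) : Pi.single u (1 : ℝ) ∈ seg u v := by
  obtain rfl : ‹DecidableEq V› = fun x y => Classical.propDecidable (x = y) :=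
    Subsingleton.elim _ _
  exact left_mem_segment ℝ _ _

lemma single_mem_seg_right [DecidableEq V] (u v : V) : Pi.single v (1 : ℝ) ∈ seg u v := by
  obtain rfl : ‹DecidableEq V› = fun x y => Classical.propDecidable (x = y) :=
    Subsingleton.elim _ _
  exact right_mem_segment ℝ _ _

lemma convex_seg (u v : V) : Convex ℝ (seg u v) := convex_segment _ _

lemma isCompact_seg (u v : V) : IsCompact (seg u v) := by
  rw [seg, segment_eq_image]
  exact isCompact_Icc.image (by fun_prop)

variable {Γ}

/-- For a point that is itself a vertex, the degenerate segment is taken, so that both end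
coordinates are nonzero. -/
lemma exists_mem_seg {w : V → ℝ} (hw : w ∈ Γ.realization) :
    ∃ u v, (u = v ∨ Γ.Adj u v) ∧ w ∈ seg u v ∧ w u ≠ 0 ∧ w v ≠ 0 := by
  classical
  obtain ⟨u, v, huv, hw⟩ := hw
  have hw' : w ∈ seg u v := hw
  obtain ⟨s, t, hs, ht, hst, h⟩ := hw
  rcases huv with rfl | huv
  · refine ⟨u, u, Or.inl rfl, hw', ?_, ?_⟩ <;>
    · rw [← h]
      simp [hst]
  by_cases hs0 : s = 0
  · subst hs0
    obtain rfl : t = 1 := by linarith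
    obtain rfl : Pi.single v (1 : ℝ) = w := by
      rw [← h]; ext x; simp [Pi.single_apply]
    exact ⟨v, v, Or.inl rfl, single_mem_seg_left v v, by simp, by simp⟩
  by_cases ht0 : t = 0
  · subst ht0
    obtain rfl : s = 1 := by linarith
    obtain rfl : Pi.single u (1 : ℝ) = w := by
      rw [← h]; ext x; simp [Pi.single_apply]
    exact ⟨u, u, Or.inl rfl, single_mem_seg_left u u, by simp, by simp⟩
  refine ⟨u, v, Or.inr huv, hw', ?_, ?_⟩
  · rw [← h]
    simpa [Pi.single_apply, huv.ne] using hs0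
  · rw [← h]
    simpa [Pi.single_apply, huv.ne'] using ht0

lemma seg_subset {u v : V} (huv : u = v ∨ Γ.Adj u v) : seg u v ⊆ Γ.realization :=
  fun _ hw => ⟨u, v, huv, hw⟩

variable (Γ)

/-- The segment between two vertices as a subset of the geometric realization. -/
def edge (u v : V) : Set Γ.realization := Subtype.val ⁻¹' seg u v

open Classical in
/-- A vertex as a point of the geometric realization. -/
noncomputable def vertex (v : V) : Γ.realization :=
  ⟨Pi.single v 1, v, v, Or.inl rfl, left_mem_segment ℝ _ _⟩

variable {Γ}

lemma image_edge {u v : V} (huv : u = v ∨ Γ.Adj u v) : Subtype.val '' edge Γ u v = seg u v := by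
  rw [edge, Subtype.image_preimage_coe, Set.inter_eq_right]
  exact seg_subset huv

lemma isCompact_edge {u v : V} (huv : u = v ∨ Γ.Adj u v) : IsCompact (edge Γ u v) := by
  rw [Subtype.isCompact_iff, image_edge huv]
  exact isCompact_seg u v

lemma isPreconnected_edge {u v : V} (huv : u = v ∨ Γ.Adj u v) : IsPreconnected (edge Γ u v) := by
  rw [← Topology.IsInducing.subtypeVal.isPreconnected_image, image_edge huv]
  exact (convex_seg u v).isPreconnected

lemma vertex_mem_edge_left (u v : V) : vertex Γ u ∈ edge Γ u v := by
  classical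
  exact single_mem_seg_left u v

lemma vertex_mem_edge_right (u v : V) : vertex Γ v ∈ edge Γ u v := by
  classical
  exact single_mem_seg_right u v

variable (Γ)

/-- The open star of a vertex. -/
def star (v : V) : Set Γ.realization := {w | w.1 v ≠ 0}

variable {Γ}

lemma isOpen_star (v : V) : IsOpen (star Γ v) :=
  isOpen_ne.preimage ((continuous_apply v).comp continuous_subtype_val)

lemma vertex_mem_star (v : V) : vertex Γ v ∈ star Γ v := by
  simp [star, vertex]

lemma exists_mem_star (w : Γ.realization) : ∃ v, w ∈ star Γ v := by
  obtain ⟨u, v, -, -, h, -⟩ := exists_mem_seg w.2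
  exact ⟨u, h⟩

/-- The open star is star-shaped about its vertex: positivity of the `v`-coordinate is a convex
condition. -/
lemma isPreconnected_star (v : V) : IsPreconnected (star Γ v) := by
  classical
  refine isPreconnected_of_forall (vertex Γ v) fun w hw => ?_
  obtain ⟨u, u', huu', hwseg⟩ := w.2
  have hv : Pi.single v (1 : ℝ) ∈ seg u u' := by
    rcases (mem_seg_apply hwseg v).2 hw with rfl | rfl
    · exact single_mem_seg_left _ _
    · exact single_mem_seg_right _ _
  have hsub : segment ℝ (Pi.single v (1 : ℝ)) w.1 ⊆ seg u u' :=
    (convex_seg u u').segment_subset hv hwseg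
  have hpos : segment ℝ (Pi.single v (1 : ℝ)) w.1 ⊆ {f | 0 < f v} := by
    refine Convex.segment_subset ?_ (by simp) (lt_of_le_of_ne (mem_seg_apply hwseg v).1 hw.symm)
    exact convex_halfSpace_gt (LinearMap.proj (R := ℝ) (φ := fun _ : V => ℝ) v).isLinear 0
  refine ⟨Subtype.val ⁻¹' segment ℝ (Pi.single v (1 : ℝ)) w.1, fun p hp => (hpos hp).ne', ?_,
    right_mem_segment ℝ _ _, ?_⟩
  · have := left_mem_segment ℝ (Pi.single v (1 : ℝ)) w.1
    convert this
    simp only [vertex]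
    congr!
  · rw [← Topology.IsInducing.subtypeVal.isPreconnected_image, Subtype.image_preimage_coe,
      Set.inter_eq_right.2 (hsub.trans (seg_subset huu'))]
    exact (convex_segment _ _).isPreconnected

lemma star_inter_star_nonempty {u v : V} (huv : Γ.Adj u v) :
    (star Γ u ∩ star Γ v).Nonempty := by
  classical
  refine ⟨⟨(1 / 2 : ℝ) • Pi.single u (1 : ℝ) + (1 / 2 : ℝ) • Pi.single v (1 : ℝ), u, v,
    Or.inr huv, ?_⟩, ?_, ?_⟩
  · refine ⟨1 / 2, 1 / 2, by norm_num, by norm_num, by norm_num, ?_⟩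
    congr!
  · simp [star, huv.ne]
  · simp [star, huv.ne']

lemma eq_or_adj_of_mem_star {u v : V} {w : Γ.realization} (hu : w ∈ star Γ u) (hv : w ∈ star Γ v) :
    u = v ∨ Γ.Adj u v := by
  obtain ⟨s, t, hst, hw⟩ := w.2
  have h1 := (mem_seg_apply hw u).2 hu
  have h2 := (mem_seg_apply hw v).2 hv
  rcases hst with rfl | hst
  · left; rw [or_self] at h1 h2; rw [h1, h2]
  · rcases h1 with rfl | rfl <;> rcases h2 with rfl | rfl
    exacts [Or.inl rfl, Or.inr hst, Or.inr hst.symm, Or.inl rfl]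

lemma exists_finite_cover {K : Set Γ.realization} (hK : IsCompact K) :
    ∃ F : Set V, F.Finite ∧ ∀ w ∈ K, ∃ v ∈ F, w ∈ star Γ v := by
  refine hK.induction_on (p := fun K => ∃ F : Set V, F.Finite ∧ ∀ w ∈ K, ∃ v ∈ F, w ∈ star Γ v)
    ⟨∅, Set.finite_empty, by simp⟩ ?_ ?_ ?_
  · rintro s t hst ⟨F, hF, h⟩
    exact ⟨F, hF, fun w hw => h w (hst hw)⟩
  · rintro s t ⟨F, hF, h⟩ ⟨F', hF', h'⟩
    refine ⟨F ∪ F', hF.union hF', ?_⟩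
    rintro w (hw | hw)
    · obtain ⟨v, hv, hvw⟩ := h w hw
      exact ⟨v, Or.inl hv, hvw⟩
    · obtain ⟨v, hv, hvw⟩ := h' w hw
      exact ⟨v, Or.inr hv, hvw⟩
  · intro w _
    obtain ⟨v, hv⟩ := exists_mem_star w
    exact ⟨star Γ v, mem_nhdsWithin_of_mem_nhds ((isOpen_star v).mem_nhds hv), {v},
      Set.finite_singleton v, fun w hw => ⟨v, rfl, hw⟩⟩

/-- A set that is covered by finitely many edges lies in a compact set. -/
lemma exists_isCompact_superset {W : Set Γ.realization} {P : Set (V × V)} (hP : P.Finite)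
    (h : ∀ w ∈ W, ∃ u v, (u, v) ∈ P ∧ (u = v ∨ Γ.Adj u v) ∧ w ∈ edge Γ u v) :
    ∃ L, IsCompact L ∧ W ⊆ L := by
  have hP' : {e ∈ P | e.1 = e.2 ∨ Γ.Adj e.1 e.2}.Finite := hP.subset (Set.sep_subset _ _)
  refine ⟨⋃ e ∈ {e ∈ P | e.1 = e.2 ∨ Γ.Adj e.1 e.2}, edge Γ e.1 e.2,
    hP'.isCompact_biUnion fun e he => isCompact_edge he.2, fun w hw => ?_⟩
  obtain ⟨u, v, huv, hadj, hwe⟩ := h w hw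
  exact Set.mem_biUnion (x := (u, v)) ⟨huv, hadj⟩ hwe

variable (Γ)

/-- The union of the open stars of the vertices in a set. -/
def starUnion (S : Set V) : Set Γ.realization := ⋃ v ∈ S, star Γ v

variable {Γ}

lemma mem_starUnion {S : Set V} {w : Γ.realization} :
    w ∈ starUnion Γ S ↔ ∃ v ∈ S, w ∈ star Γ v := by
  simp [starUnion]

lemma starUnion_mono {S T : Set V} (h : S ⊆ T) : starUnion Γ S ⊆ starUnion Γ T :=
  Set.biUnion_subset_biUnion_left h

lemma isOpen_starUnion (S : Set V) : IsOpen (starUnion Γ S) :=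
  isOpen_biUnion fun v _ => isOpen_star v

/-- A point outside the union lies on an edge with both ends in the finite set `Sᶜ`. -/
lemma isCompact_compl_starUnion {S : Set V} (hS : Sᶜ.Finite) : IsCompact (starUnion Γ S)ᶜ := by
  obtain ⟨L, hL, hSL⟩ := exists_isCompact_superset (W := (starUnion Γ S)ᶜ) (hS.prod hS) (by
    intro w hw
    obtain ⟨u, v, huv, hwuv, hu, hv⟩ := exists_mem_seg w.2
    refine ⟨u, v, ⟨fun h => hw ?_, fun h => hw ?_⟩, huv, hwuv⟩
    · exact mem_starUnion.2 ⟨u, h, hu⟩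
    · exact mem_starUnion.2 ⟨v, h, hv⟩)
  exact hL.of_isClosed_subset (isOpen_starUnion S).isClosed_compl hSL

lemma compactSpace_of_finite [Finite V] : CompactSpace Γ.realization := by
  have := isCompact_compl_starUnion (Γ := Γ) (S := ∅) (Set.toFinite _)
  simp only [starUnion, Set.mem_empty_iff_false, Set.iUnion_of_empty, Set.iUnion_empty,
    Set.compl_empty] at this
  exact isCompact_univ_iff.1 this

end realization

end SimpleGraph

/-! ### Ends of almost connected graphs -/

namespace SimpleGraph

variable {V : Type*} (Γ : SimpleGraph V)

/-- A graph on which every function with finite coboundary is constant outside a finite set. -/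
def IsAlmostConnected : Prop :=
  ∀ f : V → ℚ, {e : V × V | Γ.Adj e.1 e.2 ∧ f e.1 ≠ f e.2}.Finite → ∃ k, {v | f v ≠ k}.Finite

/-- The graph obtained by deleting all edges that meet a set of vertices. -/
def isolate (F : Set V) : SimpleGraph V where
  Adj u v := Γ.Adj u v ∧ u ∉ F ∧ v ∉ F
  symm := ⟨fun _ _ h => ⟨h.1.symm, h.2.2, h.2.1⟩⟩
  loopless := ⟨fun _ h => h.1.ne rfl⟩

/-- The vertices in the infinite components of the complement of a set of vertices. -/
def infinitePart (F : Set V) : Set V := {v | {w | (Γ.isolate F).Reachable v w}.Infinite}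

variable {Γ}

lemma infinitePart_antitone {F F' : Set V} (h : F ⊆ F') : Γ.infinitePart F' ⊆ Γ.infinitePart F := by
  have hle : Γ.isolate F' ≤ Γ.isolate F := fun _ _ hadj =>
    ⟨hadj.1, fun hF => hadj.2.1 (h hF), fun hF => hadj.2.2 (h hF)⟩
  exact fun v hv => hv.mono fun w hw => Reachable.mono hle hw

lemma infinitePart_subset_compl (F : Set V) : Γ.infinitePart F ⊆ Fᶜ := by
  intro v hv hF
  refine hv ((Set.finite_singleton v).subset fun w hw => ?_)
  rcases (Relation.ReflTransGen.cases_head (((Γ.isolate F).reachable_iff_reflTransGen v w).1 hw))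
    with h | ⟨_, h, -⟩
  · exact h.symm
  · exact absurd hF h.2.1

lemma finite_adj_of_mem_or_mem (hfin : ∀ v, {u | Γ.Adj v u}.Finite) {F : Set V} (hF : F.Finite) :
    {e : V × V | (e.1 = e.2 ∨ Γ.Adj e.1 e.2) ∧ (e.1 ∈ F ∨ e.2 ∈ F)}.Finite := by
  have hN : ∀ v, {u | u = v ∨ Γ.Adj v u}.Finite := fun v =>
    (Set.finite_singleton v).union (hfin v)
  have h1 : (⋃ v ∈ F, (Prod.mk v) '' {u | u = v ∨ Γ.Adj v u}).Finite :=
    hF.biUnion fun v _ => (hN v).image _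
  have h2 : (⋃ v ∈ F, (fun u => (u, v)) '' {u | u = v ∨ Γ.Adj v u}).Finite :=
    hF.biUnion fun v _ => (hN v).image _
  refine (h1.union h2).subset ?_
  rintro ⟨u, v⟩ ⟨huv, hu | hv⟩
  · exact Or.inl (Set.mem_biUnion hu ⟨v, huv.imp Eq.symm id, rfl⟩)
  · exact Or.inr (Set.mem_biUnion hv ⟨u, huv.imp id Adj.symm, rfl⟩)

/-- Number the components injectively. The resulting function changes only along the finitely many
edges that meet `F`, so almost all vertices carry one label. -/
lemma exists_component_finite_compl [Infinite V] [Countable V] (hΓ : Γ.IsAlmostConnected)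
    (hfin : ∀ v, {u | Γ.Adj v u}.Finite) {F : Set V} (hF : F.Finite) :
    ∃ v₀, {w | ¬(Γ.isolate F).Reachable v₀ w}.Finite := by
  have : Countable (Γ.isolate F).ConnectedComponent :=
    inferInstanceAs (Countable (Quot _))
  obtain ⟨e, he⟩ := exists_injective_nat (Γ.isolate F).ConnectedComponent
  obtain ⟨k, hk⟩ := hΓ (fun v => (e ((Γ.isolate F).connectedComponentMk v) : ℚ)) (by
    refine (finite_adj_of_mem_or_mem hfin hF).subset ?_
    rintro ⟨u, v⟩ ⟨hadj, hne⟩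
    refine ⟨Or.inr hadj, ?_⟩
    by_contra! hcon
    refine hne ?_
    have hreach : (Γ.isolate F).Reachable u v := Adj.reachable ⟨hadj, hcon⟩
    simp only [ConnectedComponent.sound hreach])
  obtain ⟨v₀, hv₀⟩ := hk.infinite_compl.nonempty
  simp only [ne_eq, Set.mem_compl_iff, Set.mem_ofPred_eq, not_not] at hv₀
  refine ⟨v₀, hk.subset fun w hw hwk => hw ?_⟩
  rw [← hv₀, Nat.cast_inj] at hwk
  exact (ConnectedComponent.exact (he hwk)).symm

lemma exists_infinitePart_eq [Infinite V] [Countable V] (hΓ : Γ.IsAlmostConnected)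
    (hfin : ∀ v, {u | Γ.Adj v u}.Finite) {F : Set V} (hF : F.Finite) :
    ∃ v₀, Γ.infinitePart F = {w | (Γ.isolate F).Reachable v₀ w} ∧ (Γ.infinitePart F)ᶜ.Finite := by
  obtain ⟨v₀, hv₀⟩ := exists_component_finite_compl hΓ hfin hF
  have heq : Γ.infinitePart F = {w | (Γ.isolate F).Reachable v₀ w} := by
    ext w
    constructor
    · intro hw
      by_contra hcon
      exact hw (hv₀.subset fun u hu hcon' => hcon (hcon'.trans (Reachable.symm hu)))
    · intro hw
      refine Set.Infinite.mono (fun u hu => ?_) hv₀.infinite_compl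
      simp only [Set.mem_compl_iff, Set.mem_ofPred_eq, not_not] at hu
      exact (Reachable.symm hw).trans hu
  exact ⟨v₀, heq, by rw [heq]; exact hv₀⟩

namespace realization

lemma isConnected_starUnion_infinitePart [Infinite V] [Countable V] (hΓ : Γ.IsAlmostConnected)
    (hfin : ∀ v, {u | Γ.Adj v u}.Finite) {F : Set V} (hF : F.Finite) :
    IsConnected (starUnion Γ (Γ.infinitePart F)) := by
  obtain ⟨v₀, heq, -⟩ := exists_infinitePart_eq hΓ hfin hF
  refine ⟨⟨vertex Γ v₀, mem_starUnion.2 ⟨v₀, by rw [heq]; exact Reachable.refl v₀,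
    vertex_mem_star v₀⟩⟩, ?_⟩
  refine IsPreconnected.biUnion_of_reflTransGen (fun v _ => isPreconnected_star v) ?_
  intro u hu v hv
  have huv : (Γ.isolate F).Reachable u v := by
    rw [heq] at hu hv
    exact (Reachable.symm hu).trans hv
  rw [reachable_iff_reflTransGen] at huv
  clear hv
  induction huv with
  | refl => exact Relation.ReflTransGen.refl
  | @tail v w h1 h2 ih =>
    refine ih.tail ⟨star_inter_star_nonempty h2.1, ?_⟩
    rw [heq] at hu ⊢
    rw [← reachable_iff_reflTransGen] at h1
    exact Reachable.trans hu h1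

/-- The standard nested sequence of a countable locally finite graph in which the complement of
each finite set has only one infinite component. -/
noncomputable def nestedSequence [Infinite V] [Countable V] (hΓ : Γ.IsAlmostConnected)
    (hfin : ∀ v, {u | Γ.Adj v u}.Finite) : NestedSequence Γ.realization := by
  let e : V → ℕ := (exists_injective_nat V).choose
  have he : Function.Injective e := (exists_injective_nat V).choose_spec
  have hF : ∀ n, {v | e v < n}.Finite := fun n =>
    (Set.finite_lt_nat n).preimage he.injOn
  let U : ℕ → Set Γ.realization := fun n => starUnion Γ (Γ.infinitePart {v | e v < n})
  have hU : Antitone U := fun m n hmn =>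
    starUnion_mono (infinitePart_antitone fun v hv => lt_of_lt_of_le hv hmn)
  have hstar : ∀ v, ∃ m, star Γ v ∩ U m = ∅ := by
    intro v
    obtain ⟨m, hm⟩ := (((Set.finite_singleton v).union (hfin v)).image e).bddAbove
    -- `m` bounds the labels of `v` and its neighbours; the deleted set is given by a strict
    -- inequality, hence `m + 1`.
    refine ⟨m + 1, Set.eq_empty_iff_forall_notMem.2 ?_⟩
    rintro w ⟨hwv, hwU⟩
    obtain ⟨u, hu, hwu⟩ := mem_starUnion.1 hwU
    refine infinitePart_subset_compl _ hu (Nat.lt_succ_of_le (hm ⟨u, ?_, rfl⟩))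
    exact (eq_or_adj_of_mem_star hwv hwu).imp Eq.symm id
  exact
    { U := U
      isOpen := fun n => isOpen_starUnion _
      isConnected := fun n => isConnected_starUnion_infinitePart hΓ hfin (hF n)
      antitone := hU
      isCompact_frontier := fun n => by
        obtain ⟨-, -, hc⟩ := exists_infinitePart_eq hΓ hfin (hF n)
        refine (isCompact_compl_starUnion hc).of_isClosed_subset isClosed_frontier ?_
        rw [(isOpen_starUnion _).frontier_eq]
        exact fun w hw => hw.2
      iInter_closure := by
        refine Set.eq_empty_iff_forall_notMem.2 fun w hw => ?_
        obtain ⟨v, hv⟩ := exists_mem_star w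
        obtain ⟨m, hm⟩ := hstar v
        have := mem_closure_iff.1 (Set.mem_iInter.1 hw m) _ (isOpen_star v) hv
        exact this.ne_empty hm
      eventually_disjoint := fun K hK => by
        obtain ⟨F, hFfin, hFK⟩ := exists_finite_cover hK
        choose m hm using hstar
        obtain ⟨M, hM⟩ := (hFfin.image m).bddAbove
        refine ⟨M, Set.eq_empty_iff_forall_notMem.2 ?_⟩
        rintro w ⟨hwK, hwU⟩
        obtain ⟨v, hv, hwv⟩ := hFK w hwK
        exact (Set.eq_empty_iff_forall_notMem.1 (hm v)) w ⟨hwv, hU (hM ⟨v, hv, rfl⟩) hwU⟩ }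

/-- A set containing only finitely many vertices and separated from its complement by finitely many
edges lies in a compact set. -/
lemma exists_isCompact_superset_of_finite (hfin : ∀ v, {u | Γ.Adj v u}.Finite)
    {W : Set Γ.realization} {F : Set V} (hF : F.Finite)
    (hW : ∀ u v, (u = v ∨ Γ.Adj u v) → ∀ p ∈ edge Γ u v, ∀ q ∈ edge Γ u v, p ∈ W → q ∉ W →
      u ∈ F ∨ v ∈ F)
    (hWfin : {v | vertex Γ v ∈ W}.Finite) : ∃ L, IsCompact L ∧ W ⊆ L := by
  refine exists_isCompact_superset (finite_adj_of_mem_or_mem hfin (hF.union hWfin)) fun w hw => ?_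
  obtain ⟨u, v, huv, hwuv⟩ := w.2
  refine ⟨u, v, ⟨huv, ?_⟩, huv, hwuv⟩
  by_contra! hcon
  rcases hW u v huv w hwuv (vertex Γ u) (vertex_mem_edge_left u v) hw
    (fun h => hcon.1 (Or.inr h)) with h | h
  · exact hcon.1 (Or.inl h)
  · exact hcon.2 (Or.inl h)

/-- An edge leaving `T.U n` crosses its compact frontier, which finitely many stars cover. So the
indicator of the vertices in `T.U n` has finite coboundary and is almost constant. -/
lemma exists_isCompact_compl_subset (hΓ : Γ.IsAlmostConnected)
    (hfin : ∀ v, {u | Γ.Adj v u}.Finite) (T : NestedSequence Γ.realization) (n : ℕ) :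
    ∃ L, IsCompact L ∧ (T.U n)ᶜ ⊆ L := by
  classical
  obtain ⟨F, hF, hcover⟩ := exists_finite_cover (T.isCompact_frontier n)
  have hsep : ∀ u v, (u = v ∨ Γ.Adj u v) → ∀ p ∈ edge Γ u v, ∀ q ∈ edge Γ u v, p ∈ T.U n →
      q ∉ T.U n → u ∈ F ∨ v ∈ F := by
    intro u v huv p hp q hq hpU hqU
    obtain ⟨w, hw, hwf⟩ :=
      (isPreconnected_edge huv).inter_frontier_nonempty_of_isOpen (T.isOpen n) hp hpU hq hqU
    obtain ⟨x, hx, hwx⟩ := hcover w hwf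
    rcases (mem_seg_apply hw x).2 hwx with rfl | rfl
    exacts [Or.inl hx, Or.inr hx]
  obtain ⟨k, hk⟩ := hΓ (fun v => if vertex Γ v ∈ T.U n then 1 else 0) (by
    refine (finite_adj_of_mem_or_mem hfin hF).subset ?_
    rintro ⟨u, v⟩ ⟨hadj, hne⟩
    refine ⟨Or.inr hadj, ?_⟩
    have hu := vertex_mem_edge_left (Γ := Γ) u v
    have hv := vertex_mem_edge_right (Γ := Γ) u v
    by_cases hu' : vertex Γ u ∈ T.U n <;> by_cases hv' : vertex Γ v ∈ T.U n
    · simp [hu', hv'] at hne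
    · exact hsep u v (Or.inr hadj) _ hu _ hv hu' hv'
    · exact hsep u v (Or.inr hadj) _ hv _ hu hv' hu'
    · simp [hu', hv'] at hne)
  -- If the constant is not 1, only finitely many vertices lie in `T.U n`, which then sits in a
  -- compact set that the sequence must leave: a contradiction.
  by_cases hk1 : k = 1
  · refine exists_isCompact_superset_of_finite hfin hF
      (fun u v huv p hp q hq hpU hqU => hsep u v huv q hq p hp (not_not.1 hqU) hpU)
      (hk.subset fun v hv => ?_)
    have hv' : vertex Γ v ∉ T.U n := hv
    simp [hv', hk1]
  · exfalso
    obtain ⟨L, hL, hUL⟩ := exists_isCompact_superset_of_finite (W := T.U n) hfin hF hsep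
      (hk.subset fun v hv => by
        have hv' : vertex Γ v ∈ T.U n := hv
        simpa [hv'] using Ne.symm hk1)
    obtain ⟨m, hm⟩ := T.eventually_disjoint L hL
    obtain ⟨w, hw⟩ := (T.isConnected (max n m)).nonempty
    exact (Set.eq_empty_iff_forall_notMem.1 hm) w
      ⟨hUL (T.antitone (le_max_left n m) hw), T.antitone (le_max_right n m) hw⟩

theorem card_topEnds_eq_one [Infinite V] [Countable V] (hΓ : Γ.IsAlmostConnected)
    (hfin : ∀ v, {u | Γ.Adj v u}.Finite) : ENat.card (TopEnds Γ.realization) = 1 :=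
  TopEnds.card_eq_one (nestedSequence hΓ hfin) (exists_isCompact_compl_subset hΓ hfin)

theorem card_topEnds_eq_zero [Finite V] : ENat.card (TopEnds Γ.realization) = 0 := by
  have : CompactSpace Γ.realization := compactSpace_of_finite
  have := NestedSequence.isEmpty_of_compactSpace Γ.realization
  rw [ENat.card_eq_zero_iff_empty]
  exact inferInstanceAs (IsEmpty (Quotient _))

end realization

/-! ### Cayley graphs and the conclusion -/

lemma finite_mulCayley_adj {G : Type*} [Group G] {C : Set G} (hC : C.Finite) (v : G) :
    {u | (mulCayley C).Adj v u}.Finite := by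
  refine ((hC.image (v * ·)).union (hC.image (v * ·⁻¹))).subset fun u hu => ?_
  obtain ⟨-, g, hg, rfl | rfl⟩ := (mulCayley_adj' C v u).1 hu
  · exact Or.inl ⟨g, hg, rfl⟩
  · exact Or.inr ⟨g, hg, by simp⟩

/-- A function with finite coboundary on a Cayley graph is almost invariant under right
multiplication by each group element. -/
lemma finite_mul_right_ne {G : Type*} [Group G] {C : Set G} (hgen : Subgroup.closure C = ⊤)
    {f : G → ℚ} (hf : {e : G × G | (mulCayley C).Adj e.1 e.2 ∧ f e.1 ≠ f e.2}.Finite) (h : G) :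
    {g | f (g * h) ≠ f g}.Finite := by
  have hmem : h ∈ Subgroup.closure C := by rw [hgen]; trivial
  induction hmem using Subgroup.closure_induction with
  | mem c hc =>
    refine (hf.preimage (f := fun g => (g, g * c))
      (fun _ _ _ _ heq => (Prod.ext_iff.1 heq).1)).subset fun g hg => ?_
    refine ⟨(mulCayley_adj' C _ _).2 ⟨fun heq => hg ?_, c, hc, Or.inl rfl⟩, Ne.symm hg⟩
    exact congrArg f heq.symm
  | one => simp
  | mul x y _ _ hx hy =>
    refine (hx.union (hy.preimage (mul_left_injective x).injOn)).subset fun g hg => ?_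
    by_contra hcon
    simp only [Set.mem_union, Set.mem_preimage, Set.mem_ofPred_eq, not_or, not_not] at hcon hg
    exact hg (by rw [← mul_assoc, hcon.2, hcon.1])
  | inv x _ hx =>
    refine (hx.preimage (mul_left_injective x⁻¹).injOn).subset fun g hg => ?_
    simp only [Set.mem_preimage, Set.mem_ofPred_eq, inv_mul_cancel_right] at hg ⊢
    exact Ne.symm hg

end SimpleGraph

lemma TriangleGroup.isAlmostConnected_mulCayley {a b c : ℕ} (ha : 0 < a) (hb : 0 < b) (hc : 0 < c)
    {C : Set (TriangleGroup a b c)} (hgen : Subgroup.closure C = ⊤) :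
    (SimpleGraph.mulCayley C).IsAlmostConnected := fun f hf =>
  exists_finite_ne ha hb hc f (SimpleGraph.finite_mul_right_ne hgen hf _)
    (SimpleGraph.finite_mul_right_ne hgen hf _)

theorem mainTheorem6 (a b c : ℕ) (ha : 0 < a) (hb : 0 < b) (hc : 0 < c)
    (C : Set (TriangleGroup a b c)) (hC : C.Finite) (hinv : ∀ g ∈ C, g⁻¹ ∈ C)
    (hgen : Subgroup.closure C = ⊤) :
    ((1 / a + 1 / b + 1 / c : ℚ) ≤ 1 → ENat.card (GroupEnds C) = 1) ∧
      (Finite (TriangleGroup a b c) → ENat.card (GroupEnds C) = 0) := by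
  refine ⟨fun h => ?_, fun _ => SimpleGraph.realization.card_topEnds_eq_zero⟩
  have := TriangleGroup.infinite_of_inv_add_inv_add_inv_le ha hb hc h
  have : Countable (TriangleGroup a b c) := (PresentedGroup.mk_surjective _).countable
  exact SimpleGraph.realization.card_topEnds_eq_one
    (TriangleGroup.isAlmostConnected_mulCayley ha hb hc hgen)
    (SimpleGraph.finite_mulCayley_adj hC)
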